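/- **Proposition 2.1.** Let $\alpha,\kappa\ge 0$, let $C,D\subset\mathbb R^d$, let $I\subset[0,\infty]$ be closed, and let $g,h:\mathbb R^d\to[0,\infty)$, where $h$ is upper semicontinuous (usc) and $\int h(x)\,dx<\infty$. Let $$F=\Big\{f:\mathbb R^d\to[0,\infty]\ \Big|\ f\text{ usc},\ \int f(x)\,dx=1,\ C\subset\operatorname{argmax} f,\ D\subset\{x: f(x)\ge\alpha\},\ \sup f\in I,\ g\le f\le h,\ |f(x)-f(y)|\le\kappa\|x-y\|_2\ \ \forall x,y\in\mathbb R^d\Big\},$$ where $\operatorname{argmax} f$ is the set of global maximizers of $f$, and assume $F\neq\emptyset$. For a usc function $f:\mathbb R^d\to[-\infty,\infty]$, $f\not\equiv-\infty$, let $\operatorname{hypo} f=\{(x,a)\in\mathbb R^d\times\mathbb R: f(x)\ge a\}$. Fix any centre $\bar x\in\mathbb R^d\times\mathbb R$ and the norm $\|(x,a)\|=\max\{\|x\|_2,|a|\}$ on $\mathbb R^d\times\mathbb R$. On the set of all such functions the aw-distance (Attouch–Wets distance) is $$d(f,f')=\int_0^\infty \Big(\max_{\|z-\bar x\|\le\rho}\big|\operatorname{dist}(z,\operatorname{hypo}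 f)-\operatorname{dist}(z,\operatorname{hypo} f')\big|\Big)e^{-\rho}\,d\rho .$$ For measurable $p,f:\mathbb R^d\to[0,\infty]$ let $K(p;f)=\int p(x)\,[\log p(x)-\log f(x)]\,dx$ be the Kullback–Leibler divergence, with $\log 0=-\infty$, $\log\infty=\infty$, $0\cdot(\pm\infty)=0$ and $\infty-\infty=\infty$. For $\epsilon\ge0$ and $\phi:F\to[-\infty,\infty]$ let $\epsilon\text{-}\operatorname{argmin}_{f\in F}\phi(f)=\{f\in F:\phi(f)\le\inf_{F}\phi+\epsilon\}$. Let $X^1,X^2,\dots$ be iid random vectors in $\mathbb R^d$, each distributed according to a density $f^0:\mathbb R^d\to[0,\infty]$, and let $\epsilon^n\ge0$ be real numbers with $\epsilon^n\to0$. Then, almost surely: 1. for every $n\ge1$ there exists $\hat f^n\in\epsilon^n\text{-}\operatorname{argmin}_{f\in F}\,-\frac1n\sum_{j=1}^n\log f(X^j)$; and for every sequence $(\hat f^n)_{n\ge1}$ of such near-minimizers: 2. $(\hat f^n)$ has at least one cluster point (a limit of a subsequence, under the aw-distance, in the space of usc functions above), and every cluster point belongs to $F$ and minimizes $K(f^0;f)$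 over $f\in F$; 3. if $f^0\in F$, then $\hat f^n\to f^0$ under the aw-distance. -/

import Mathlib

open MeasureTheory ProbabilityTheory Filter Topology
open scoped ENNReal NNReal

noncomputable section

namespace AwML

/-- `ℝ^d` with the Euclidean norm. -/
abbrev Rd (d : ℕ) : Type := EuclideanSpace ℝ (Fin d)

/-- The hypograph `{(x, a) ∈ ℝ^d × ℝ | f x ≥ a}` of an extended real-valued function. -/
def hypo {d : ℕ} (f : Rd d → EReal) : Set (Rd d × ℝ) :=
  {z | (z.2 : EReal) ≤ f z.1}

/-- The upper semicontinuous functions `ℝ^d → [-∞, ∞]` that are not identically `-∞`;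
equivalently, the functions with a nonempty closed hypograph. -/
def uscFcns (d : ℕ) : Set (Rd d → EReal) :=
  {f | UpperSemicontinuous f ∧ ∃ x, f x ≠ ⊥}

/-- The `ρ`-aw-distance with centre `c`: the largest difference, over the closed ball of radius
`ρ` around `c`, of the distances to the two hypographs. The norm on `ℝ^d × ℝ` is
`‖(x, a)‖ = max ‖x‖₂ |a|`. -/
def awDistAt {d : ℕ} (c : Rd d × ℝ) (ρ : ℝ) (f g : Rd d → EReal) : ℝ :=
  ⨆ z : Metric.closedBall c ρ,
    |Metric.infDist (z : Rd d × ℝ) (hypo f) - Metric.infDist (z : Rd d × ℝ) (hypo g)|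

/-- The Attouch-Wets distance `∫_0^∞ d_ρ(f, g) e^{-ρ} dρ` with centre `c`. -/
def awDist {d : ℕ} (c : Rd d × ℝ) (f g : Rd d → EReal) : ℝ :=
  ∫ ρ in Set.Ioi (0 : ℝ), awDistAt c ρ f g * Real.exp (-ρ)

/-- A `[0, ∞]`-valued function, seen as a `[-∞, ∞]`-valued one. -/
def toExt {d : ℕ} (f : Rd d → ℝ≥0∞) : Rd d → EReal := fun x => (f x : EReal)

/-- `u` is a cluster point of the sequence `f` in the space of usc functions with the
aw-distance: a limit of a subsequence. -/
def IsAwClusterPt {d : ℕ} (c : Rd d × ℝ) (f : ℕ → Rd d → EReal) (u : Rd d → EReal) : Prop :=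
  u ∈ uscFcns d ∧
    ∃ φ : ℕ → ℕ, StrictMono φ ∧ Tendsto (fun k => awDist c (f (φ k)) u) atTop (𝓝 0)

/-- The (global) maximizers of `f`. -/
def argmax {d : ℕ} (f : Rd d → ℝ≥0∞) : Set (Rd d) := {y | (⨆ x, f x) ≤ f y}

/-- The super-level set of `f` at level `a`. -/
def superLevel {d : ℕ} (a : ℝ≥0∞) (f : Rd d → ℝ≥0∞) : Set (Rd d) := {x | a ≤ f x}

/-- The class of densities. In the last condition all values of `f` are finite,
because `f ≤ h` and `h` is finite. -/
def densityClass {d : ℕ} (C D : Set (Rd d)) (I : Set ℝ≥0∞) (α κ : ℝ≥0) (g h : Rd d → ℝ≥0) :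
    Set (Rd d → ℝ≥0∞) :=
  {f | UpperSemicontinuous f ∧ ∫⁻ x, f x = 1 ∧
    C ⊆ argmax f ∧ D ⊆ superLevel α f ∧ (⨆ x, f x) ∈ I ∧
    (∀ x, (g x : ℝ≥0∞) ≤ f x ∧ f x ≤ (h x : ℝ≥0∞)) ∧
    ∀ x y, |(f x).toReal - (f y).toReal| ≤ κ * ‖x - y‖}

/-- The near-minimizers `ε-argmin_{f ∈ F} φ f`. -/
def epsArgmin {β : Type*} (ε : ℝ) (F : Set β) (φ : β → EReal) : Set β :=
  {f | f ∈ F ∧ φ f ≤ (⨅ g ∈ F, φ g) + (ε : EReal)}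

/-- The maximum likelihood criterion `-n⁻¹ ∑ log f(x_j)`, over the first `n` points
`x 0, …, x (n - 1)` of a sample, with `log 0 = -∞` and `log ∞ = ∞`. -/
def mlCriterion {d : ℕ} (n : ℕ) (x : ℕ → Rd d) (f : Rd d → ℝ≥0∞) : EReal :=
  -((((n : ℝ)⁻¹ : ℝ) : EReal) * ∑ j ∈ Finset.range n, ENNReal.log (f (x j)))

/-- The Lebesgue integral over `ℝ^d` of an extended real-valued function: the integral of the
positive part minus that of the negative part, with the convention `∞ - ∞ = ∞`. -/
def extIntegral {d : ℕ} (u : Rd d → EReal) : EReal :=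
  if ∫⁻ x, (u x).toENNReal = ⊤ then ⊤
  else ((∫⁻ x, (u x).toENNReal : ℝ≥0∞) : EReal) - ((∫⁻ x, (-u x).toENNReal : ℝ≥0∞) : EReal)

/-- The Kullback-Leibler divergence `K(g; f) = ∫ g(x) [log g(x) - log f(x)] dx`, where
`0 · (±∞) = 0`. -/
def kl {d : ℕ} (g f : Rd d → ℝ≥0∞) : EReal :=
  extIntegral fun x => (g x : EReal) * (ENNReal.log (g x) - ENNReal.log (f x))

end AwML

end

/-! The proof is Wald's consistency argument on a compact class. Members of the class are finite,
`κ`-Lipschitz and dominated by the integrable `h`, so they form a compact subset of `C(ℝ^d, ℝ)` with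
the compact-open topology (`isCompact_contClass`). Domination and the common Lipschitz constant
upgrade convergence there to uniform convergence (`eventually_abs_sub_le`), hence to aw-convergence
(`tendsto_awDist_ofCont`). A near-minimizing sequence therefore has convergent subsequences, and the
point is to show that their limits minimize the divergence.

The loss `log f₀ - log f` may fail to be integrable and has no fixed sign. Adding `h / f₀`, whose
mean under `f₀` is at most `∫ h < ∞`, makes it nonnegative, since `log (f / f₀) ≤ f / f₀ ≤ h / f₀`.
This is `excess`. The added term does not depend on `f`, so `excess` ranks densities as both the
likelihood (`average_excess_le`) and the divergence (`kl_eq`) do. By nonnegativity, the strong law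
holds even with infinite mean, and Fatou's lemma applies.

The exceptional null set must not depend on `f`, so the strong law is used only countably often: for
the upper envelopes of the class over a countable basis of open sets, and for a minimizing sequence
of the mean excess. The excess decreases in `f`, so the average at an estimator lying in `U` is at
least the average at the envelope over `U`. Shrinking `U` to the limit point gives the bound
(`lintegral_excess_le_of_tendsto`). If `f₀` is in the class, the equality case of `log t ≤ t - 1`
identifies every limit with `f₀`. -/

namespace AwML

/-! ### Compactness of the class of densities -/

/-- The `[0, ∞]`-valued function induced by a continuous real one. -/
noncomputable def ofCont {d : ℕ} (f : C(Rd d, ℝ)) : Rd d → ℝ≥0∞ := fun x => ENNReal.ofReal (f x)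

/-- The nonnegative `κ`-Lipschitz functions below `h`. -/
def envelope {d : ℕ} (κ : ℝ≥0) (h : Rd d → ℝ≥0) : Set C(Rd d, ℝ) :=
  {f | (∀ x, f x ∈ Set.Icc 0 (h x : ℝ)) ∧ ∀ x y, |f x - f y| ≤ κ * ‖x - y‖}

/-- The class of densities, as a set of continuous functions. -/
def contClass {d : ℕ} (C D : Set (Rd d)) (I : Set ℝ≥0∞) (α κ : ℝ≥0) (g h : Rd d → ℝ≥0) :
    Set C(Rd d, ℝ) :=
  {f | f ∈ envelope κ h ∧ ofCont f ∈ densityClass C D I α κ g h}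

theorem continuous_ofCont {d : ℕ} (f : C(Rd d, ℝ)) : Continuous (ofCont f) :=
  ENNReal.continuous_ofReal.comp f.continuous

theorem exists_ofCont_eq {d : ℕ} {C D : Set (Rd d)} {I : Set ℝ≥0∞} {α κ : ℝ≥0}
    {g h : Rd d → ℝ≥0} {f : Rd d → ℝ≥0∞} (hf : f ∈ densityClass C D I α κ g h) :
    ∃ F ∈ contClass C D I α κ g h, ofCont F = f := by
  obtain ⟨h1, h2, h3, h4, h5, h6, h7⟩ := id hf
  have hfin : ∀ x, f x ≠ ⊤ := fun x => ne_top_of_le_ne_top ENNReal.coe_ne_top (h6 x).2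
  have hcont : Continuous fun x => (f x).toReal := by
    have : LipschitzWith κ fun x => (f x).toReal :=
      LipschitzWith.of_dist_le_mul fun x y => by
        rw [Real.dist_eq, dist_eq_norm]; exact h7 x y
    exact this.continuous
  have he : ofCont ⟨_, hcont⟩ = f := by
    funext x
    exact ENNReal.ofReal_toReal (hfin x)
  refine ⟨⟨_, hcont⟩, ⟨⟨fun x => ⟨ENNReal.toReal_nonneg, ?_⟩, h7⟩, by rw [he]; exact hf⟩, he⟩
  have := ENNReal.toReal_mono ENNReal.coe_ne_top (h6 x).2
  simpa using this

theorem isCompact_envelope {d : ℕ} (κ : ℝ≥0) (h : Rd d → ℝ≥0) : IsCompact (envelope κ h) := by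
  apply ArzelaAscoli.isCompact_of_equicontinuous
  -- The Lipschitz inequality already forces continuity, so the image is cut out by pointwise
  -- conditions alone: a closed subset of a product of compact intervals.
  · have himg : ContinuousMap.toFun '' envelope κ h =
        (Set.univ.pi fun x => Set.Icc 0 (h x : ℝ)) ∩
          {f | ∀ x y, |f x - f y| ≤ κ * ‖x - y‖} := by
      ext f
      constructor
      · rintro ⟨F, hF, rfl⟩
        exact ⟨fun x _ => hF.1 x, hF.2⟩
      · rintro ⟨h1, h2⟩
        have : LipschitzWith κ f := LipschitzWith.of_dist_le_mul fun x y => by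
          rw [Real.dist_eq, dist_eq_norm]; exact h2 x y
        exact ⟨⟨f, this.continuous⟩, ⟨fun x => h1 x trivial, h2⟩, rfl⟩
    rw [himg]
    refine (isCompact_univ_pi fun x => isCompact_Icc).inter_right ?_
    simp only [Set.ofPred_forall]
    refine isClosed_iInter fun x => isClosed_iInter fun y => ?_
    exact isClosed_le (by fun_prop) continuous_const
  · apply UniformEquicontinuous.equicontinuous
    refine LipschitzWith.uniformEquicontinuous _ κ fun f => ?_
    refine LipschitzWith.of_dist_le_mul fun x y => ?_
    rw [Real.dist_eq, dist_eq_norm]; exact f.2.2 x y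

/-- Domination by `h` turns pointwise into `L¹` convergence. A gap above `δ` at one point persists,
at size `δ / 2`, on a ball whose radius depends only on `δ` and `κ`, which costs a fixed amount of
`L¹` distance wherever the point lies. -/
theorem eventually_abs_sub_le {d : ℕ} {κ : ℝ≥0} {h : Rd d → ℝ≥0}
    (h_int : ∫⁻ x, (h x : ℝ≥0∞) < ⊤) {F : ℕ → C(Rd d, ℝ)} {f : C(Rd d, ℝ)}
    (hF : ∀ n, F n ∈ envelope κ h) (hf : f ∈ envelope κ h)
    (hlim : ∀ x, Tendsto (fun n => F n x) atTop (𝓝 (f x))) {δ : ℝ} (hδ : 0 < δ) :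
    ∀ᶠ n in atTop, ∀ x, |F n x - f x| ≤ δ := by
  have hL1 : Tendsto (fun n => ∫⁻ x, ENNReal.ofReal |F n x - f x|) atTop (𝓝 0) := by
    have := tendsto_lintegral_of_dominated_convergence (μ := (volume : Measure (Rd d)))
      (F := fun n x => ENNReal.ofReal |F n x - f x|) (f := fun _ => 0)
      (fun x => (h x : ℝ≥0∞))
      (fun n => (ENNReal.continuous_ofReal.comp
        ((F n).continuous.sub f.continuous).abs).measurable)
      (fun n => Eventually.of_forall fun x => ?_) h_int.ne
      (Eventually.of_forall fun x => ?_)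
    · simpa using this
    · have h1 := (hF n).1 x
      have h2 := hf.1 x
      have : |F n x - f x| ≤ h x := abs_le.2 ⟨by linarith [h1.1, h2.2], by linarith [h1.2, h2.1]⟩
      calc ENNReal.ofReal |F n x - f x| ≤ ENNReal.ofReal (h x) := ENNReal.ofReal_le_ofReal this
        _ = h x := ENNReal.ofReal_coe_nnreal
    · have : Tendsto (fun n => |F n x - f x|) atTop (𝓝 |f x - f x|) :=
        ((hlim x).sub tendsto_const_nhds).abs
      have := ENNReal.tendsto_ofReal this
      simpa using this
  -- Within this radius each of the two functions varies by at most `δ / 4`, so their gap drops by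
  -- at most `δ / 2`. The `+ 1` covers `κ = 0`.
  set r : ℝ := δ / (4 * (κ + 1)) with hr
  have hκ : (0 : ℝ) ≤ κ := κ.2
  have hrpos : 0 < r := by positivity
  have hc : 0 < ENNReal.ofReal (δ / 2) * volume (Metric.ball (0 : Rd d) r) :=
    ENNReal.mul_pos (by simpa using hδ) (Metric.measure_ball_pos _ _ hrpos).ne'
  filter_upwards [hL1.eventually (gt_mem_nhds hc)] with n hn x
  by_contra! hx
  refine absurd hn (not_lt.2 ?_)
  rw [← Measure.addHaar_ball_center volume x r]
  calc ENNReal.ofReal (δ / 2) * volume (Metric.ball x r)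
      = ∫⁻ _ in Metric.ball x r, ENNReal.ofReal (δ / 2) := by rw [setLIntegral_const]
    _ ≤ ∫⁻ y in Metric.ball x r, ENNReal.ofReal |F n y - f y| := by
        refine setLIntegral_mono' Metric.isOpen_ball.measurableSet fun y hy => ?_
        apply ENNReal.ofReal_le_ofReal
        have hy' : ‖x - y‖ ≤ r := by
          rw [← dist_eq_norm, dist_comm]; exact (Metric.mem_ball.1 hy).le
        have e1 := (hF n).2 x y
        have e2 := hf.2 x y
        have e3 : κ * ‖x - y‖ ≤ δ / 4 := by
          calc κ * ‖x - y‖ ≤ (κ + 1) * r := by gcongr; linarith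
            _ = δ / 4 := by rw [hr]; field_simp
        have e4 : |F n x - f x| ≤ |F n y - f y| + |F n x - F n y| + |f x - f y| := by
          have : F n x - f x = (F n y - f y) + (F n x - F n y) - (f x - f y) := by ring
          rw [this]
          exact (abs_sub _ _).trans (by gcongr; exact abs_add_le _ _)
        linarith
    _ ≤ ∫⁻ y, ENNReal.ofReal |F n y - f y| := setLIntegral_le_lintegral _ _

theorem tendsto_ofCont {d : ℕ} {F : ℕ → C(Rd d, ℝ)} {f : C(Rd d, ℝ)} (x : Rd d)
    (h : Tendsto F atTop (𝓝 f)) : Tendsto (fun n => ofCont (F n) x) atTop (𝓝 (ofCont f x)) :=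
  ENNReal.tendsto_ofReal (((continuous_eval_const x).tendsto f).comp h)

theorem ofCont_le {d : ℕ} {κ : ℝ≥0} {h : Rd d → ℝ≥0} {f : C(Rd d, ℝ)} (hf : f ∈ envelope κ h)
    (x : Rd d) : ofCont f x ≤ h x :=
  (ENNReal.ofReal_le_ofReal (hf.1 x).2).trans_eq ENNReal.ofReal_coe_nnreal

theorem isCompact_contClass {d : ℕ} {C D : Set (Rd d)} {I : Set ℝ≥0∞} (hI : IsClosed I)
    {α κ : ℝ≥0} {g h : Rd d → ℝ≥0} (h_int : ∫⁻ x, (h x : ℝ≥0∞) < ⊤) :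
    IsCompact (contClass C D I α κ g h) := by
  refine (isCompact_envelope κ h).of_isClosed_subset ?_ fun f hf => hf.1
  refine IsSeqClosed.isClosed fun F f hF hlim => ?_
  have hfe : f ∈ envelope κ h :=
    (isCompact_envelope κ h).isClosed.isSeqClosed (fun n => (hF n).1) hlim
  have hpt : ∀ x, Tendsto (fun n => ofCont (F n) x) atTop (𝓝 (ofCont f x)) :=
    fun x => tendsto_ofCont x hlim
  have hunif := fun δ (hδ : (0 : ℝ) < δ) => eventually_abs_sub_le h_int (fun n => (hF n).1) hfe
    (fun x => ((continuous_eval_const x).tendsto f).comp hlim) hδ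
  have hnn : ∀ x, (ofCont f x).toReal = f x := fun x => ENNReal.toReal_ofReal (hfe.1 x).1
  refine ⟨hfe, (continuous_ofCont f).upperSemicontinuous, ?_, fun y hy => ?_, fun y hy => ?_, ?_,
    fun x => ⟨?_, ofCont_le hfe x⟩, fun x y => ?_⟩
  · have := tendsto_lintegral_of_dominated_convergence (μ := (volume : Measure (Rd d)))
      (F := fun n => ofCont (F n)) (f := ofCont f) (fun x => (h x : ℝ≥0∞))
      (fun n => (continuous_ofCont (F n)).measurable)
      (fun n => Eventually.of_forall fun x => ofCont_le (hF n).1 x) h_int.ne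
      (Eventually.of_forall hpt)
    refine tendsto_nhds_unique this ?_
    simp only [(hF _).2.2.1]
    exact tendsto_const_nhds
  · exact iSup_le fun x => le_of_tendsto_of_tendsto' (hpt x) (hpt y) fun n =>
      (le_iSup (ofCont (F n)) x).trans ((hF n).2.2.2.1 hy)
  · exact ge_of_tendsto' (hpt y) fun n => (hF n).2.2.2.2.1 hy
  · refine hI.mem_of_tendsto (f := fun n => ⨆ x, ofCont (F n) x) (b := atTop) ?_
      (Eventually.of_forall fun n => (hF n).2.2.2.2.2.1)
    -- Pointwise convergence bounds the suprema from below; the upper bound needs uniform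
    -- convergence, since near-maximizers could otherwise escape to infinity.
    refine tendsto_order.2 ⟨fun a ha => ?_, fun b hb => ?_⟩
    · obtain ⟨x, hx⟩ := lt_iSup_iff.1 ha
      filter_upwards [(hpt x).eventually (lt_mem_nhds hx)] with n hn
      exact hn.trans_le (le_iSup (ofCont (F n)) x)
    · obtain ⟨b', hb', hb'b⟩ := exists_between hb
      obtain ⟨r, hr, hrb⟩ := ENNReal.lt_iff_exists_add_pos_lt.1 hb'
      filter_upwards [hunif r (NNReal.coe_pos.2 hr)] with n hn
      refine lt_of_le_of_lt (iSup_le fun x => ?_) (hrb.trans hb'b)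
      have h1 : F n x ≤ f x + r := by linarith [(abs_le.1 (hn x)).2]
      calc ofCont (F n) x ≤ ENNReal.ofReal (f x + r) := ENNReal.ofReal_le_ofReal h1
        _ = ofCont f x + r := by
          rw [ENNReal.ofReal_add (hfe.1 x).1 r.coe_nonneg, ENNReal.ofReal_coe_nnreal]; rfl
        _ ≤ (⨆ x, ofCont f x) + r := by gcongr; exact le_iSup (ofCont f) x
  · exact ge_of_tendsto' (hpt x) fun n => ((hF n).2.2.2.2.2.2.1 x).1
  · rw [hnn, hnn]; exact hfe.2 x y

/-! ### The Attouch–Wets distance -/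

theorem hypo_nonempty {d : ℕ} {f : Rd d → EReal} (hf : f ∈ uscFcns d) : (hypo f).Nonempty := by
  obtain ⟨x, hx⟩ := hf.2
  obtain ⟨a, ha⟩ := EReal.lt_iff_exists_real_btwn.1 (bot_lt_iff_ne_bot.2 hx)
  exact ⟨(x, a), ha.2.le⟩

theorem isClosed_hypo {d : ℕ} {f : Rd d → EReal} (hf : f ∈ uscFcns d) : IsClosed (hypo f) :=
  hf.1.IsClosed_hypograph.preimage
    (f := fun z : Rd d × ℝ => (z.1, (z.2 : EReal)))
    (continuous_fst.prodMk (continuous_coe_real_ereal.comp continuous_snd))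

theorem eq_of_hypo_eq {d : ℕ} {f g : Rd d → EReal} (h : hypo f = hypo g) : f = g := by
  have key : ∀ {f g : Rd d → EReal}, hypo f = hypo g → ∀ x, f x ≤ g x := by
    intro f g h x
    refine EReal.ge_of_forall_gt_iff_ge.1 fun a ha => ?_
    have : (x, a) ∈ hypo f := ha.le
    rw [h] at this
    exact this
  exact funext fun x => le_antisymm (key h x) (key h.symm x)

theorem toExt_mem_uscFcns {d : ℕ} {f : Rd d → ℝ≥0∞} (hf : UpperSemicontinuous f) :
    toExt f ∈ uscFcns d :=
  ⟨continuous_coe_ennreal_ereal.comp_upperSemicontinuous hf EReal.coe_ennreal_strictMono.monotone,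
    0, EReal.coe_ennreal_ne_bot _⟩

theorem abs_infDist_sub_le {d : ℕ} (c : Rd d × ℝ) {f g : Rd d → EReal} {ρ : ℝ}
    {z : Rd d × ℝ} (hz : z ∈ Metric.closedBall c ρ) :
    |Metric.infDist z (hypo f) - Metric.infDist z (hypo g)| ≤
      Metric.infDist c (hypo f) + Metric.infDist c (hypo g) + 2 * ρ := by
  have h1 : Metric.infDist z (hypo f) ≤ Metric.infDist c (hypo f) + dist z c :=
    Metric.infDist_le_infDist_add_dist
  have h2 : Metric.infDist z (hypo g) ≤ Metric.infDist c (hypo g) + dist z c :=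
    Metric.infDist_le_infDist_add_dist
  have h3 : dist z c ≤ ρ := hz
  have h4 := Metric.infDist_nonneg (x := z) (s := hypo f)
  have h5 := Metric.infDist_nonneg (x := z) (s := hypo g)
  rw [abs_le]
  constructor <;> linarith [Metric.infDist_nonneg (x := c) (s := hypo f),
    Metric.infDist_nonneg (x := c) (s := hypo g)]

theorem bddAbove_range_infDist_sub {d : ℕ} (c : Rd d × ℝ) (ρ : ℝ) (f g : Rd d → EReal) :
    BddAbove (Set.range fun z : Metric.closedBall c ρ =>
      |Metric.infDist (z : Rd d × ℝ) (hypo f) - Metric.infDist (z : Rd d × ℝ) (hypo g)|) := by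
  refine ⟨Metric.infDist c (hypo f) + Metric.infDist c (hypo g) + 2 * ρ, ?_⟩
  rintro _ ⟨z, rfl⟩
  exact abs_infDist_sub_le c z.2

theorem le_awDistAt {d : ℕ} {c : Rd d × ℝ} {ρ : ℝ} (f g : Rd d → EReal) {z : Rd d × ℝ}
    (hz : z ∈ Metric.closedBall c ρ) :
    |Metric.infDist z (hypo f) - Metric.infDist z (hypo g)| ≤ awDistAt c ρ f g :=
  le_ciSup (bddAbove_range_infDist_sub c ρ f g) ⟨z, hz⟩

theorem awDistAt_nonneg {d : ℕ} (c : Rd d × ℝ) (ρ : ℝ) (f g : Rd d → EReal) :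
    0 ≤ awDistAt c ρ f g :=
  Real.iSup_nonneg fun _ => abs_nonneg _

theorem awDistAt_le {d : ℕ} {c : Rd d × ℝ} {ρ : ℝ} (hρ : 0 ≤ ρ) {f g : Rd d → EReal} {b : ℝ}
    (h : ∀ z ∈ Metric.closedBall c ρ,
      |Metric.infDist z (hypo f) - Metric.infDist z (hypo g)| ≤ b) :
    awDistAt c ρ f g ≤ b :=
  haveI : Nonempty (Metric.closedBall c ρ) := ⟨⟨c, Metric.mem_closedBall_self hρ⟩⟩
  ciSup_le fun z => h z z.2

theorem integrableOn_awDistAt {d : ℕ} (c : Rd d × ℝ) (f g : Rd d → EReal) :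
    IntegrableOn (fun ρ => awDistAt c ρ f g * Real.exp (-ρ)) (Set.Ioi 0) := by
  set B := Metric.infDist c (hypo f) + Metric.infDist c (hypo g)
  have hB : 0 ≤ B := add_nonneg Metric.infDist_nonneg Metric.infDist_nonneg
  -- Monotonicity in `ρ` supplies measurability; the linear bound in `ρ` supplies integrability.
  have hmono : MonotoneOn (fun ρ => awDistAt c ρ f g) (Set.Ioi 0) := fun a ha b _ hab =>
    awDistAt_le (Set.mem_Ioi.1 ha).le fun z hz =>
      le_awDistAt f g (Metric.closedBall_subset_closedBall hab hz)
  have hint : IntegrableOn (fun ρ : ℝ => B * Real.exp (-ρ) + 2 * (Real.exp (-ρ) * ρ))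
      (Set.Ioi 0) := by
    have h1 := Real.GammaIntegral_convergent (s := 1) one_pos
    have h2 := Real.GammaIntegral_convergent (s := 2) two_pos
    norm_num at h1 h2
    exact (h1.const_mul B).add (h2.const_mul 2)
  refine Integrable.mono' hint ?_ ?_
  · exact ((aemeasurable_restrict_of_monotoneOn measurableSet_Ioi hmono).mul
      (by fun_prop)).aestronglyMeasurable
  · refine (ae_restrict_iff' measurableSet_Ioi).2 (Eventually.of_forall fun ρ hρ => ?_)
    rw [Real.norm_of_nonneg (mul_nonneg (awDistAt_nonneg _ _ _ _) (Real.exp_pos _).le)]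
    have : awDistAt c ρ f g ≤ B + 2 * ρ :=
      awDistAt_le (Set.mem_Ioi.1 hρ).le fun z hz => abs_infDist_sub_le c hz
    calc _ ≤ (B + 2 * ρ) * Real.exp (-ρ) := by gcongr
      _ = _ := by ring

theorem awDist_nonneg {d : ℕ} (c : Rd d × ℝ) (f g : Rd d → EReal) : 0 ≤ awDist c f g :=
  setIntegral_nonneg measurableSet_Ioi fun _ _ =>
    mul_nonneg (awDistAt_nonneg _ _ _ _) (Real.exp_pos _).le

theorem awDist_le_of_forall_awDistAt_le {d : ℕ} {c : Rd d × ℝ} {f g : Rd d → EReal} {δ : ℝ}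
    (h : ∀ ρ, 0 < ρ → awDistAt c ρ f g ≤ δ) : awDist c f g ≤ δ := by
  have h1 : IntegrableOn (fun ρ : ℝ => δ * Real.exp (-ρ)) (Set.Ioi 0) :=
    (integrableOn_exp_neg_Ioi 0).const_mul δ
  calc awDist c f g ≤ ∫ ρ in Set.Ioi (0 : ℝ), δ * Real.exp (-ρ) :=
        setIntegral_mono_on (integrableOn_awDistAt c f g) h1 measurableSet_Ioi
          fun ρ hρ => by gcongr; exact h ρ hρ
    _ = δ := by rw [integral_const_mul, integral_exp_neg_Ioi_zero, mul_one]

theorem awDistAt_triangle {d : ℕ} (c : Rd d × ℝ) {ρ : ℝ} (hρ : 0 ≤ ρ) (f g k : Rd d → EReal) :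
    awDistAt c ρ f k ≤ awDistAt c ρ f g + awDistAt c ρ g k :=
  awDistAt_le hρ fun z hz => (abs_sub_le _ (Metric.infDist z (hypo g)) _).trans
    (add_le_add (le_awDistAt f g hz) (le_awDistAt g k hz))

theorem awDist_triangle {d : ℕ} (c : Rd d × ℝ) (f g k : Rd d → EReal) :
    awDist c f k ≤ awDist c f g + awDist c g k := by
  unfold awDist
  rw [← integral_add (integrableOn_awDistAt c f g) (integrableOn_awDistAt c g k)]
  refine setIntegral_mono_on (integrableOn_awDistAt c f k)
    ((integrableOn_awDistAt c f g).add (integrableOn_awDistAt c g k)) measurableSet_Ioi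
    fun ρ hρ => ?_
  rw [← add_mul]
  gcongr
  exact awDistAt_triangle c (Set.mem_Ioi.1 hρ).le f g k

theorem awDist_comm {d : ℕ} (c : Rd d × ℝ) (f g : Rd d → EReal) :
    awDist c f g = awDist c g f := by
  unfold awDist awDistAt
  simp only [abs_sub_comm]

theorem eq_of_awDist_le_zero {d : ℕ} {c : Rd d × ℝ} {f g : Rd d → EReal} (hf : f ∈ uscFcns d)
    (hg : g ∈ uscFcns d) (h : awDist c f g ≤ 0) : f = g := by
  have h0 : awDist c f g = 0 := h.antisymm (awDist_nonneg c f g)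
  have hae := (setIntegral_eq_zero_iff_of_nonneg_ae
    (Eventually.of_forall fun ρ => mul_nonneg (awDistAt_nonneg c ρ f g) (Real.exp_pos _).le)
    (integrableOn_awDistAt c f g)).1 h0
  have hz : ∀ z : Rd d × ℝ, Metric.infDist z (hypo f) = Metric.infDist z (hypo g) := by
    intro z
    -- The integrand vanishes only for almost every radius, but the radii whose ball contains `z`
    -- have positive measure, so one of them works.
    have hne : (volume.restrict (Set.Ioi (0 : ℝ))) (Set.Ioi (dist z c)) ≠ 0 := by
      rw [Measure.restrict_apply measurableSet_Ioi, Set.Ioi_inter_Ioi]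
      simp
    obtain ⟨ρ, hρ, hρ0⟩ := ((frequently_ae_iff.2 hne).and_eventually hae).exists
    have hzero : awDistAt c ρ f g = 0 := by
      rcases mul_eq_zero.1 hρ0 with h | h
      · exact h
      · exact absurd h (Real.exp_pos _).ne'
    have := le_awDistAt f g (Metric.mem_closedBall.2 (le_of_lt hρ))
    rw [hzero] at this
    exact sub_eq_zero.1 (abs_nonpos_iff.1 this)
  refine eq_of_hypo_eq (Set.ext fun z => ?_)
  rw [(isClosed_hypo hf).mem_iff_infDist_zero (hypo_nonempty hf),
    (isClosed_hypo hg).mem_iff_infDist_zero (hypo_nonempty hg), hz]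

theorem infDist_hypo_le {d : ℕ} {f g : Rd d → EReal} {δ : ℝ} (hg : g ∈ uscFcns d)
    (h : ∀ x, g x ≤ f x + δ) (z : Rd d × ℝ) (hδ : 0 ≤ δ) :
    Metric.infDist z (hypo f) ≤ Metric.infDist z (hypo g) + δ := by
  rw [← sub_le_iff_le_add]
  refine (Metric.le_infDist (hypo_nonempty hg)).2 fun w hw => ?_
  -- Lowering a point of `hypo g` by `δ` lands in `hypo f` and moves it by exactly `δ` in the max
  -- norm.
  have hw' : (w.1, w.2 - δ) ∈ hypo f := by
    have : (w.2 : EReal) ≤ f w.1 + δ := le_trans hw (h w.1)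
    change ((w.2 - δ : ℝ) : EReal) ≤ f w.1
    rw [EReal.coe_sub]
    exact EReal.sub_le_of_le_add this
  have h1 := Metric.infDist_le_dist_of_mem (x := z) hw'
  have h2 := dist_triangle z w (w.1, w.2 - δ)
  have h3 : dist w (w.1, w.2 - δ) = δ := by
    rw [Prod.dist_eq, Real.dist_eq]
    simp [abs_of_nonneg hδ, hδ]
  linarith

theorem awDist_le_of_forall_le_add {d : ℕ} (c : Rd d × ℝ) {f g : Rd d → EReal} {δ : ℝ}
    (hf : f ∈ uscFcns d) (hg : g ∈ uscFcns d) (hδ : 0 ≤ δ) (hfg : ∀ x, f x ≤ g x + δ)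
    (hgf : ∀ x, g x ≤ f x + δ) : awDist c f g ≤ δ := by
  refine awDist_le_of_forall_awDistAt_le fun ρ hρ => awDistAt_le hρ.le fun z _ => ?_
  rw [abs_le]
  constructor <;> linarith [infDist_hypo_le hg hgf z hδ, infDist_hypo_le hf hfg z hδ]

/-! ### Strong law of large numbers for nonnegative functions -/

theorem tendsto_average_of_lintegral_ne_top {E Ω : Type*} [MeasurableSpace E] [MeasurableSpace Ω]
    {P : Measure Ω} {μ : Measure E} {X : ℕ → Ω → E}
    (hX : ∀ j, Measurable (X j)) (hX_indep : iIndepFun X P) (hX_law : ∀ j, P.map (X j) = μ)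
    {L : E → ℝ≥0∞} (hL : Measurable L) (hfin : ∫⁻ x, L x ∂μ ≠ ⊤) :
    ∀ᵐ ω ∂P, Tendsto (fun n : ℕ => (∑ j ∈ Finset.range n, L (X j ω)) / n) atTop
      (𝓝 (∫⁻ x, L x ∂μ)) := by
  have hlt : ∀ᵐ ω ∂P, ∀ j, L (X j ω) < ⊤ := ae_all_iff.2 fun j =>
    ae_of_ae_map (hX j).aemeasurable (by rw [hX_law j]; exact ae_lt_top hL hfin)
  have hmap : ∫⁻ ω, L (X 0 ω) ∂P = ∫⁻ x, L x ∂μ := by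
    rw [← hX_law 0, lintegral_map hL (hX 0)]
  have hslln := strong_law_ae_real (μ := P) (fun j ω => (L (X j ω)).toReal)
    (integrable_toReal_of_lintegral_ne_top (hL.comp (hX 0)).aemeasurable
      (by simpa only [Function.comp_def, hmap] using hfin))
    (fun i j hij => (hX_indep.indepFun hij).comp hL.ennreal_toReal hL.ennreal_toReal)
    (fun i => (IdentDistrib.mk (hX i).aemeasurable (hX 0).aemeasurable
      (by rw [hX_law, hX_law])).comp hL.ennreal_toReal)
  have hmean : ENNReal.ofReal (∫ ω, (L (X 0 ω)).toReal ∂P) = ∫⁻ x, L x ∂μ := by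
    have hm : Measurable fun ω => L (X 0 ω) := hL.comp (hX 0)
    rw [integral_toReal hm.aemeasurable (hlt.mono fun ω h => h 0),
      ← hmap, ENNReal.ofReal_toReal (by rwa [hmap])]
  filter_upwards [hslln, hlt] with ω hω hω'
  rw [← hmean]
  refine (ENNReal.tendsto_ofReal hω).congr' ?_
  filter_upwards [eventually_gt_atTop 0] with n hn
  rw [ENNReal.ofReal_div_of_pos (by exact_mod_cast hn),
    ENNReal.ofReal_sum_of_nonneg fun _ _ => ENNReal.toReal_nonneg, ENNReal.ofReal_natCast]
  congr 1
  exact Finset.sum_congr rfl fun j _ => ENNReal.ofReal_toReal (hω' j).ne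

/-- The strong law of large numbers for `[0, ∞]`-valued functions of an iid sample, including the
case of an infinite mean. -/
theorem tendsto_average_lintegral {E Ω : Type*} [MeasurableSpace E] [MeasurableSpace Ω]
    {P : Measure Ω} {μ : Measure E} [IsFiniteMeasure μ] {X : ℕ → Ω → E}
    (hX : ∀ j, Measurable (X j)) (hX_indep : iIndepFun X P) (hX_law : ∀ j, P.map (X j) = μ)
    {L : E → ℝ≥0∞} (hL : Measurable L) :
    ∀ᵐ ω ∂P, Tendsto (fun n : ℕ => (∑ j ∈ Finset.range n, L (X j ω)) / n) atTop
      (𝓝 (∫⁻ x, L x ∂μ)) := by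
  by_cases hfin : ∫⁻ x, L x ∂μ = ⊤
  swap
  · exact tendsto_average_of_lintegral_ne_top hX hX_indep hX_law hL hfin
  -- With infinite mean, the averages dominate those of each truncation at `m`, whose limits tend to
  -- `∞` by monotone convergence.
  have htrunc : ∀ m : ℕ, ∫⁻ x, min (L x) m ∂μ ≠ ⊤ := fun m =>
    ne_top_of_le_ne_top
      (ENNReal.mul_ne_top (ENNReal.natCast_ne_top m) (measure_ne_top μ Set.univ))
      ((lintegral_mono fun x => min_le_right _ _).trans_eq (lintegral_const _))
  have hae := ae_all_iff.2 fun m : ℕ => tendsto_average_of_lintegral_ne_top hX hX_indep hX_law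
    (hL.min measurable_const) (htrunc m)
  have hsup : ⨆ m : ℕ, ∫⁻ x, min (L x) m ∂μ = ⊤ := by
    rw [← lintegral_iSup (fun m => hL.min measurable_const)
      (fun a b hab x => min_le_min le_rfl (by exact_mod_cast hab)), ← hfin]
    refine lintegral_congr fun x => ?_
    rw [← inf_iSup_eq (L x) fun m : ℕ => (m : ℝ≥0∞), ENNReal.iSup_natCast, inf_top_eq]
  filter_upwards [hae] with ω hω
  rw [hfin]
  refine tendsto_order.2 ⟨fun a ha => ?_, fun b hb => absurd hb not_top_lt⟩
  obtain ⟨m, hm⟩ := lt_iSup_iff.1 (hsup.symm ▸ ha)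
  filter_upwards [(hω m).eventually (lt_mem_nhds hm)] with n hn
  refine hn.trans_le ?_
  gcongr
  exact min_le_left _ _

/-! ### The excess: a nonnegative surrogate for the log-likelihood ratio -/

/-- The nonnegative quantity `log (a / s) + b / a`, for `s ≤ b`. -/
noncomputable def excess (a b s : ℝ≥0∞) : ℝ≥0∞ :=
  (ENNReal.log (a / s)).toENNReal + (b / a - (ENNReal.log (s / a)).toENNReal)

theorem toENNReal_log_le (t : ℝ≥0∞) : (ENNReal.log t).toENNReal ≤ t := by
  rcases eq_or_ne t 0 with rfl | h0
  · simp
  rcases eq_or_ne t ⊤ with rfl | h1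
  · simp
  rw [ENNReal.log_pos_real h0 h1, EReal.real_coe_toENNReal]
  exact ENNReal.ofReal_le_of_le_toReal (Real.log_le_self ENNReal.toReal_nonneg)

/-- Splitting the logarithm into positive and negative parts makes each summand decreasing in `s`.
Truncated subtraction keeps this true without `s ≤ b`. -/
theorem excess_anti (a b : ℝ≥0∞) : Antitone (excess a b) := by
  intro s t hst
  refine add_le_add (EReal.toENNReal_le_toENNReal (ENNReal.log_monotone ?_))
    (tsub_le_tsub le_rfl (EReal.toENNReal_le_toENNReal (ENNReal.log_monotone ?_)))
  · gcongr
  · gcongr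

theorem tendsto_excess {a b : ℝ≥0∞} (ha : a ≠ 0) (ha' : a ≠ ⊤) (hb : b ≠ ⊤) {s : ℕ → ℝ≥0∞}
    {t : ℝ≥0∞} (h : Tendsto s atTop (𝓝 t)) :
    Tendsto (fun n => excess a b (s n)) atTop (𝓝 (excess a b t)) := by
  have hc : Continuous fun y => (ENNReal.log y).toENNReal :=
    EReal.continuous_toENNReal.comp ENNReal.continuous_log
  refine ((hc.tendsto _).comp (ENNReal.Tendsto.const_div h (Or.inr ha'))).add ?_
  refine ENNReal.Tendsto.sub tendsto_const_nhds
    ((hc.tendsto _).comp (ENNReal.Tendsto.div_const h (Or.inr ha)))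
    (Or.inl (ENNReal.div_ne_top hb ha))

theorem measurable_excess {E : Type*} [MeasurableSpace E] {a b s : E → ℝ≥0∞} (ha : Measurable a)
    (hb : Measurable b) (hs : Measurable s) : Measurable fun x => excess (a x) (b x) (s x) :=
  ((ha.div hs).ennreal_log.ereal_toENNReal).add
    ((hb.div ha).sub (hs.div ha).ennreal_log.ereal_toENNReal)

theorem excess_zero {a b : ℝ≥0∞} (ha : a ≠ 0) : excess a b 0 = ⊤ := by
  simp [excess, ENNReal.div_zero ha]

theorem excess_self {a b : ℝ≥0∞} (ha : a ≠ 0) (ha' : a ≠ ⊤) : excess a b a = b / a := by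
  simp [excess, ENNReal.div_self ha ha']

theorem excess_nonneg_real {a b s : ℝ} (ha : 0 < a) (hs : 0 < s) (hsb : s ≤ b) :
    0 ≤ Real.log a - Real.log s + b / a := by
  have h1 := Real.log_le_self (div_pos hs ha).le
  rw [Real.log_div hs.ne' ha.ne'] at h1
  have h2 : s / a ≤ b / a := by gcongr
  linarith

theorem excess_ofReal {a b s : ℝ} (ha : 0 < a) (hs : 0 < s) (hsb : s ≤ b) :
    excess (ENNReal.ofReal a) (ENNReal.ofReal b) (ENNReal.ofReal s) =
      ENNReal.ofReal (Real.log a - Real.log s + b / a) := by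
  have h := excess_nonneg_real ha hs hsb
  rw [excess, ← ENNReal.ofReal_div_of_pos hs, ← ENNReal.ofReal_div_of_pos ha,
    ← ENNReal.ofReal_div_of_pos ha, ENNReal.log_ofReal_of_pos (div_pos ha hs),
    ENNReal.log_ofReal_of_pos (div_pos hs ha), EReal.real_coe_toENNReal,
    EReal.real_coe_toENNReal, Real.log_div ha.ne' hs.ne', Real.log_div hs.ne' ha.ne']
  rcases le_total (Real.log s) (Real.log a) with hl | hl
  · rw [ENNReal.ofReal_of_nonpos (sub_nonpos.2 hl), tsub_zero,
      ← ENNReal.ofReal_add (sub_nonneg.2 hl) (div_nonneg (hs.le.trans hsb) ha.le)]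
  · rw [ENNReal.ofReal_of_nonpos (sub_nonpos.2 hl), zero_add,
      ← ENNReal.ofReal_sub _ (sub_nonneg.2 hl)]
    congr 1
    ring

/-- This is `log t ≤ t - 1` at `t = s / a`, with its equality case, rearranged to avoid subtraction
in `ℝ≥0∞`. -/
theorem div_add_one_le_excess_add {a b s : ℝ≥0∞} (ha : a ≠ 0) (ha' : a ≠ ⊤) (hb : b ≠ ⊤)
    (hsb : s ≤ b) :
    b / a + 1 ≤ excess a b s + s / a ∧ (b / a + 1 = excess a b s + s / a → s = a) := by
  rcases eq_or_ne s 0 with rfl | hs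
  · rw [excess_zero ha, top_add]
    refine ⟨le_top, fun h => ?_⟩
    exact absurd h (ENNReal.add_ne_top.2 ⟨ENNReal.div_ne_top hb ha, ENNReal.one_ne_top⟩)
  have hs' : s ≠ ⊤ := ne_top_of_le_ne_top hb hsb
  have hsb' := ENNReal.toReal_mono hb hsb
  have pa := ENNReal.toReal_pos ha ha'
  have ps := ENNReal.toReal_pos hs hs'
  rw [← ENNReal.ofReal_toReal ha', ← ENNReal.ofReal_toReal hb, ← ENNReal.ofReal_toReal hs']
  set a' := a.toReal
  set b' := b.toReal
  set s' := s.toReal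
  have hnn := excess_nonneg_real pa ps hsb'
  have pb : 0 ≤ b' := ps.le.trans hsb'
  have hlog : Real.log (s' / a') = Real.log s' - Real.log a' := Real.log_div ps.ne' pa.ne'
  rw [excess_ofReal pa ps hsb', ← ENNReal.ofReal_div_of_pos pa, ← ENNReal.ofReal_div_of_pos pa,
    ← ENNReal.ofReal_one, ← ENNReal.ofReal_add (by positivity) zero_le_one,
    ← ENNReal.ofReal_add hnn (by positivity)]
  constructor
  · apply ENNReal.ofReal_le_ofReal
    have := Real.log_le_sub_one_of_pos (div_pos ps pa)
    linarith
  · intro h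
    rw [ENNReal.ofReal_eq_ofReal_iff (by positivity) (by positivity)] at h
    have h1 : s' / a' = 1 := by
      by_contra hne
      have := Real.log_lt_sub_one_of_pos (div_pos ps pa) hne
      linarith
    rw [(div_eq_one_iff_eq pa.ne').1 h1]

/-! ### The likelihood criterion and its minimizers -/

theorem sum_log_eq_log_prod {ι : Type*} (s : Finset ι) (f : ι → ℝ≥0∞) :
    ∑ j ∈ s, ENNReal.log (f j) = ENNReal.log (∏ j ∈ s, f j) := by
  classical
  induction s using Finset.induction_on with
  | empty => simp
  | insert a s ha ih => rw [Finset.sum_insert ha, Finset.prod_insert ha, ENNReal.log_mul_add, ih]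

theorem mlCriterion_anti {d : ℕ} {n : ℕ} {x : ℕ → Rd d} {f g : Rd d → ℝ≥0∞}
    (h : ∏ j ∈ Finset.range n, f (x j) ≤ ∏ j ∈ Finset.range n, g (x j)) :
    mlCriterion n x g ≤ mlCriterion n x f := by
  unfold mlCriterion
  rw [sum_log_eq_log_prod, sum_log_eq_log_prod, EReal.neg_le_neg_iff]
  exact mul_le_mul_of_nonneg_left (ENNReal.log_monotone h)
    (EReal.coe_nonneg.2 (by positivity))

theorem mlCriterion_of_ne_zero {d : ℕ} {n : ℕ} {x : ℕ → Rd d} {f : Rd d → ℝ≥0∞}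
    (h0 : ∀ j ∈ Finset.range n, f (x j) ≠ 0) (htop : ∀ j ∈ Finset.range n, f (x j) ≠ ⊤) :
    mlCriterion n x f =
      ((-((n : ℝ)⁻¹ * ∑ j ∈ Finset.range n, Real.log (f (x j)).toReal) : ℝ) : EReal) := by
  unfold mlCriterion
  rw [sum_log_eq_log_prod, ENNReal.log_pos_real (Finset.prod_ne_zero_iff.2 h0)
    (ENNReal.prod_ne_top htop), ENNReal.toReal_prod, Real.log_prod fun j hj =>
      (ENNReal.toReal_pos (h0 j hj) (htop j hj)).ne']
  norm_cast

theorem mlCriterion_eq_top {d : ℕ} {n : ℕ} {x : ℕ → Rd d} {f : Rd d → ℝ≥0∞} {j : ℕ} (hj : j < n)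
    (h0 : f (x j) = 0) : mlCriterion n x f = ⊤ := by
  unfold mlCriterion
  rw [sum_log_eq_log_prod, Finset.prod_eq_zero (Finset.mem_range.2 hj) h0, ENNReal.log_zero,
    EReal.coe_mul_bot_of_pos (by positivity [hj.pos]), EReal.neg_bot]

/-- The criterion and the average excess differ by the average of `log f₀ + h / f₀` over the sample,
which is finite and common to `f` and `g`. Zeros at sample points are treated apart: a zero of `g`
makes the right side infinite, and otherwise `hle` rules out zeros of `f`. -/
theorem average_excess_le {d : ℕ} {h : Rd d → ℝ≥0} {f₀ f g : Rd d → ℝ≥0∞} {x : ℕ → Rd d} {n : ℕ}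
    (hn : 0 < n) (h0 : ∀ j, f₀ (x j) ≠ 0) (htop : ∀ j, f₀ (x j) ≠ ⊤)
    (hf : ∀ y, f y ≤ h y) (hg : ∀ y, g y ≤ h y) {ε : ℝ} (hε : 0 ≤ ε)
    (hle : mlCriterion n x f ≤ mlCriterion n x g + ε) :
    (∑ j ∈ Finset.range n, excess (f₀ (x j)) (h (x j)) (f (x j))) / n ≤
      (∑ j ∈ Finset.range n, excess (f₀ (x j)) (h (x j)) (g (x j))) / n + ENNReal.ofReal ε := by
  by_cases hg0 : ∃ j ∈ Finset.range n, g (x j) = 0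
  · obtain ⟨j, hj, hj0⟩ := hg0
    have : ∑ j ∈ Finset.range n, excess (f₀ (x j)) (h (x j)) (g (x j)) = ⊤ :=
      ENNReal.sum_eq_top.2 ⟨j, hj, by rw [hj0, excess_zero (h0 j)]⟩
    rw [this, ENNReal.top_div_of_ne_top (ENNReal.natCast_ne_top n), top_add]
    exact le_top
  push Not at hg0
  have hftop : ∀ y, f y ≠ ⊤ := fun y => ne_top_of_le_ne_top ENNReal.coe_ne_top (hf y)
  have hgtop : ∀ y, g y ≠ ⊤ := fun y => ne_top_of_le_ne_top ENNReal.coe_ne_top (hg y)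
  rw [mlCriterion_of_ne_zero hg0 fun j _ => hgtop _] at hle
  have hf0 : ∀ j ∈ Finset.range n, f (x j) ≠ 0 := by
    intro j hj hj0
    rw [mlCriterion_eq_top (Finset.mem_range.1 hj) hj0, ← EReal.coe_add] at hle
    exact absurd hle (not_le.2 (EReal.coe_lt_top _))
  rw [mlCriterion_of_ne_zero hf0 fun j _ => hftop _, ← EReal.coe_add, EReal.coe_le_coe_iff] at hle
  have key : ∀ s : Rd d → ℝ≥0∞, (∀ y, s y ≤ h y) → (∀ j ∈ Finset.range n, s (x j) ≠ 0) →
      (∑ j ∈ Finset.range n, excess (f₀ (x j)) (h (x j)) (s (x j))) / n =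
        ENNReal.ofReal ((∑ j ∈ Finset.range n, (Real.log (f₀ (x j)).toReal -
          Real.log (s (x j)).toReal + h (x j) / (f₀ (x j)).toReal)) / n) ∧
      0 ≤ (∑ j ∈ Finset.range n, (Real.log (f₀ (x j)).toReal -
          Real.log (s (x j)).toReal + h (x j) / (f₀ (x j)).toReal)) / n := by
    intro s hs hs0
    have hs_fin : ∀ y, s y ≠ ⊤ := fun y => ne_top_of_le_ne_top ENNReal.coe_ne_top (hs y)
    have hpos := fun j => ENNReal.toReal_pos (h0 j) (htop j)
    have hspos := fun j hj => ENNReal.toReal_pos (hs0 j hj) (hs_fin (x j))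
    have hsle : ∀ y, (s y).toReal ≤ h y := fun y => by
      simpa using ENNReal.toReal_mono ENNReal.coe_ne_top (hs y)
    have hnn := fun j hj => excess_nonneg_real (hpos j) (hspos j hj) (hsle (x j))
    refine ⟨?_, div_nonneg (Finset.sum_nonneg hnn) n.cast_nonneg⟩
    rw [ENNReal.ofReal_div_of_pos (by exact_mod_cast hn), ENNReal.ofReal_sum_of_nonneg hnn,
      ENNReal.ofReal_natCast]
    congr 1
    refine Finset.sum_congr rfl fun j hj => ?_
    rw [← excess_ofReal (hpos j) (hspos j hj) (hsle (x j)), ENNReal.ofReal_toReal (htop j),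
      ENNReal.ofReal_toReal (hs_fin _), ENNReal.ofReal_coe_nnreal]
  rw [(key f hf hf0).1, (key g hg hg0).1, ← ENNReal.ofReal_add (key g hg hg0).2 hε]
  apply ENNReal.ofReal_le_ofReal
  simp only [Finset.sum_add_distrib, Finset.sum_sub_distrib, add_div, sub_div]
  simp only [div_eq_inv_mul] at hle ⊢
  linarith

/-- The likelihood product is continuous and attains its maximum on the compact class. Working with
the product avoids the singularity of the logarithm at `0`. -/
theorem epsArgmin_mlCriterion_nonempty {d : ℕ} {C D : Set (Rd d)} {I : Set ℝ≥0∞}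
    (hI : IsClosed I) {α κ : ℝ≥0} {g h : Rd d → ℝ≥0} (h_int : ∫⁻ x, (h x : ℝ≥0∞) < ⊤)
    (hF : (densityClass C D I α κ g h).Nonempty) {ε : ℝ} (hε : 0 ≤ ε) (n : ℕ) (x : ℕ → Rd d) :
    (epsArgmin ε (densityClass C D I α κ g h) (mlCriterion n x)).Nonempty := by
  obtain ⟨f₁, hf₁⟩ := hF
  obtain ⟨F₁, hF₁, -⟩ := exists_ofCont_eq hf₁
  have hcont : Continuous fun f : C(Rd d, ℝ) => ∏ j ∈ Finset.range n, f (x j) :=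
    continuous_finsetProd _ fun j _ => continuous_eval_const (x j)
  obtain ⟨F, hF, hmax⟩ := (isCompact_contClass hI h_int).exists_isMaxOn ⟨F₁, hF₁⟩
    hcont.continuousOn
  refine ⟨ofCont F, hF.2, le_trans (le_iInf₂ fun f hf => ?_)
    (le_add_of_nonneg_right (EReal.coe_nonneg.2 hε))⟩
  obtain ⟨G, hG, rfl⟩ := exists_ofCont_eq hf
  apply mlCriterion_anti
  unfold ofCont
  rw [← ENNReal.ofReal_prod_of_nonneg fun j _ => (hG.1.1 _).1,
    ← ENNReal.ofReal_prod_of_nonneg fun j _ => (hF.1.1 _).1]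
  exact ENNReal.ofReal_le_ofReal (hmax hG)

/-! ### The Kullback–Leibler divergence as a mean excess -/

theorem lintegral_div_withDensity_le {E : Type*} [MeasurableSpace E] {μ : Measure E}
    {f₀ s : E → ℝ≥0∞} (hf₀ : Measurable f₀) (hs : Measurable s) :
    ∫⁻ x, s x / f₀ x ∂(μ.withDensity f₀) ≤ ∫⁻ x, s x ∂μ := by
  have hm : Measurable fun x => s x / f₀ x := hs.div hf₀
  rw [lintegral_withDensity_eq_lintegral_mul μ hf₀ hm]
  exact lintegral_mono fun x => ENNReal.mul_div_le

theorem ae_withDensity_pos_lt_top {E : Type*} [MeasurableSpace E] {μ : Measure E}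
    {f₀ : E → ℝ≥0∞} (hf₀ : Measurable f₀) (hint : ∫⁻ x, f₀ x ∂μ ≠ ⊤) :
    ∀ᵐ x ∂(μ.withDensity f₀), f₀ x ≠ 0 ∧ f₀ x ≠ ⊤ := by
  rw [ae_withDensity_iff hf₀]
  filter_upwards [ae_lt_top hf₀ hint] with x hx h0
  exact ⟨h0, hx.ne⟩

/-- The Kullback-Leibler divergence is, up to a finite constant, the mean of the excess. -/
theorem kl_eq {d : ℕ} {f₀ f : Rd d → ℝ≥0∞} {h : Rd d → ℝ≥0} (hf₀ : Measurable f₀)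
    (hint : ∫⁻ x, f₀ x ≠ ⊤) (hh : Measurable h) (h_int : ∫⁻ x, (h x : ℝ≥0∞) < ⊤)
    (hf : Measurable f) (hfh : ∀ x, f x ≤ h x) :
    kl f₀ f = ((∫⁻ x, excess (f₀ x) (h x) (f x) ∂(volume.withDensity f₀) : ℝ≥0∞) : EReal) -
      ((∫⁻ x, h x / f₀ x ∂(volume.withDensity f₀) : ℝ≥0∞) : EReal) := by
  have mp : Measurable fun x => (ENNReal.log (f₀ x / f x)).toENNReal :=
    (hf₀.div hf).ennreal_log.ereal_toENNReal
  have mq : Measurable fun x => (ENNReal.log (f x / f₀ x)).toENNReal :=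
    (hf.div hf₀).ennreal_log.ereal_toENNReal
  have hpos : ∫⁻ x, ((f₀ x : EReal) * (ENNReal.log (f₀ x) - ENNReal.log (f x))).toENNReal =
      ∫⁻ x, (ENNReal.log (f₀ x / f x)).toENNReal ∂(volume.withDensity f₀) := by
    rw [lintegral_withDensity_eq_lintegral_mul volume hf₀ mp]
    refine lintegral_congr fun x => ?_
    rw [EReal.toENNReal_mul (EReal.coe_ennreal_nonneg _), EReal.toENNReal_coe, sub_eq_add_neg,
      ← ENNReal.log_inv, ← ENNReal.log_mul_add, ← div_eq_mul_inv]
    rfl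
  have hneg : ∫⁻ x, (-((f₀ x : EReal) * (ENNReal.log (f₀ x) - ENNReal.log (f x)))).toENNReal =
      ∫⁻ x, (ENNReal.log (f x / f₀ x)).toENNReal ∂(volume.withDensity f₀) := by
    rw [lintegral_withDensity_eq_lintegral_mul volume hf₀ mq]
    refine lintegral_congr_ae ?_
    filter_upwards [ae_lt_top hf₀ hint] with x hx
    rcases eq_or_ne (f₀ x) 0 with h0 | h0
    · simp [h0]
    rw [← mul_neg, EReal.toENNReal_mul (EReal.coe_ennreal_nonneg _), EReal.toENNReal_coe,
      sub_eq_add_neg, ← ENNReal.log_inv, ← ENNReal.log_mul_add, ← ENNReal.log_inv,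
      ENNReal.mul_inv (Or.inl h0) (Or.inl hx.ne), inv_inv, mul_comm (f₀ x)⁻¹, ← div_eq_mul_inv]
    rfl
  -- The negative part of the integrand is controlled by `h / f₀`, of finite mean, so `∞ - ∞` cannot
  -- occur.
  have hle : ∀ x, (ENNReal.log (f x / f₀ x)).toENNReal ≤ h x / f₀ x := fun x =>
    (toENNReal_log_le _).trans (by gcongr; exact hfh x)
  have hH : ∫⁻ x, h x / f₀ x ∂(volume.withDensity f₀) ≠ ⊤ :=
    ne_top_of_le_ne_top h_int.ne (lintegral_div_withDensity_le hf₀ hh.coe_nnreal_ennreal)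
  have hN : ∫⁻ x, (ENNReal.log (f x / f₀ x)).toENNReal ∂(volume.withDensity f₀) ≤
      ∫⁻ x, h x / f₀ x ∂(volume.withDensity f₀) := lintegral_mono hle
  have hex : ∫⁻ x, excess (f₀ x) (h x) (f x) ∂(volume.withDensity f₀) =
      ∫⁻ x, (ENNReal.log (f₀ x / f x)).toENNReal ∂(volume.withDensity f₀) +
        (∫⁻ x, h x / f₀ x ∂(volume.withDensity f₀) -
          ∫⁻ x, (ENNReal.log (f x / f₀ x)).toENNReal ∂(volume.withDensity f₀)) := by
    unfold excess
    rw [lintegral_add_left mp, lintegral_sub mq (ne_top_of_le_ne_top hH hN)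
        (Eventually.of_forall hle)]
  rw [hex, kl, extIntegral, hpos, hneg]
  generalize ∫⁻ x, (ENNReal.log (f₀ x / f x)).toENNReal ∂(volume.withDensity f₀) = p at *
  generalize ∫⁻ x, (ENNReal.log (f x / f₀ x)).toENNReal ∂(volume.withDensity f₀) = q at *
  generalize ∫⁻ x, h x / f₀ x ∂(volume.withDensity f₀) = b at *
  have hq := ne_top_of_le_ne_top hH hN
  lift q to ℝ≥0 using hq
  lift b to ℝ≥0 using hH
  induction p with
  | top => simp only [if_true, top_add, EReal.coe_ennreal_top]; rfl
  | coe p =>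
    rw [if_neg ENNReal.coe_ne_top, ← ENNReal.coe_sub, ← ENNReal.coe_add]
    simp only [EReal.coe_nnreal_eq_coe_real, ← EReal.coe_sub]
    rw [NNReal.coe_add, NNReal.coe_sub (by exact_mod_cast hN)]
    congr 1
    ring

/-! ### Upper envelopes, and limits of near-minimizers -/

/-- The pointwise supremum of a family of continuous functions. -/
noncomputable def upperEnvelope {d : ℕ} (S : Set C(Rd d, ℝ)) : Rd d → ℝ≥0∞ :=
  fun x => ⨆ f ∈ S, ofCont f x

theorem measurable_upperEnvelope {d : ℕ} (S : Set C(Rd d, ℝ)) : Measurable (upperEnvelope S) :=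
  (lowerSemicontinuous_biSup fun f _ => (continuous_ofCont f).lowerSemicontinuous).measurable

/-- The mean excess is at most a bound for the mean excess of the upper envelopes of small
neighbourhoods. -/
theorem lintegral_excess_le_of_basis {d : ℕ} {μ : Measure (Rd d)} {f₀ : Rd d → ℝ≥0∞}
    {h : Rd d → ℝ≥0} (hf₀ : Measurable f₀) (hμ : ∀ᵐ x ∂μ, f₀ x ≠ 0 ∧ f₀ x ≠ ⊤)
    (hh : Measurable h) {S : Set C(Rd d, ℝ)} {f : C(Rd d, ℝ)} (hf : f ∈ S) {b : ℝ≥0∞}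
    (hb : ∀ U ∈ TopologicalSpace.countableBasis C(Rd d, ℝ), f ∈ U →
      ∫⁻ x, excess (f₀ x) (h x) (upperEnvelope (S ∩ U) x) ∂μ ≤ b) :
    ∫⁻ x, excess (f₀ x) (h x) (ofCont f x) ∂μ ≤ b := by
  obtain ⟨V, hV⟩ := (𝓝 f).exists_antitone_basis
  have hex : ∀ m, ∃ U ∈ TopologicalSpace.countableBasis C(Rd d, ℝ), f ∈ U ∧ U ⊆ V m := fun m =>
    (TopologicalSpace.isBasis_countableBasis _).mem_nhds_iff.1 (hV.1.mem_of_mem trivial)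
  choose U hU hfU hUV using hex
  have hlim : ∀ x, Tendsto (fun m => upperEnvelope (S ∩ U m) x) atTop (𝓝 (ofCont f x)) := by
    intro x
    refine tendsto_order.2 ⟨fun a ha => Eventually.of_forall fun m => ha.trans_le ?_,
      fun b hb => ?_⟩
    · exact le_iSup₂ (f := fun (g : C(Rd d, ℝ)) (_ : g ∈ S ∩ U m) => ofCont g x) f ⟨hf, hfU m⟩
    · obtain ⟨b', hb', hb'b⟩ := exists_between hb
      have hnhds : {g : C(Rd d, ℝ) | ofCont g x < b'} ∈ 𝓝 f :=
        (ENNReal.continuous_ofReal.comp (continuous_eval_const x)).continuousAt.eventually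
          (gt_mem_nhds hb')
      obtain ⟨m₀, -, hm₀⟩ := hV.1.mem_iff.1 hnhds
      filter_upwards [eventually_ge_atTop m₀] with m hm
      refine lt_of_le_of_lt (iSup₂_le fun g hg => ?_) hb'b
      exact le_of_lt (hm₀ (hV.2 hm (hUV m hg.2)))
  -- Fatou's lemma along neighbourhoods shrinking to `f`; no integrable lower bound is needed
  -- because the excess is nonnegative.
  calc ∫⁻ x, excess (f₀ x) (h x) (ofCont f x) ∂μ
      = ∫⁻ x, liminf (fun m => excess (f₀ x) (h x) (upperEnvelope (S ∩ U m) x)) atTop ∂μ := by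
        refine lintegral_congr_ae ?_
        filter_upwards [hμ] with x hx
        exact (tendsto_excess hx.1 hx.2 ENNReal.coe_ne_top (hlim x)).liminf_eq.symm
    _ ≤ liminf (fun m => ∫⁻ x, excess (f₀ x) (h x) (upperEnvelope (S ∩ U m) x) ∂μ) atTop :=
        lintegral_liminf_le fun m =>
          measurable_excess hf₀ hh.coe_nnreal_ennreal (measurable_upperEnvelope _)
    _ ≤ b := liminf_le_of_le (by isBoundedDefault) fun c hc => by
        obtain ⟨m, hm⟩ := hc.exists
        exact hm.trans (hb _ (hU m) (hfU m))

/-- Integrating the pointwise bound `h / f₀ + 1 ≤ excess + f / f₀` against `f₀` gives Gibbs'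
inequality. The hypothesis forces equality of the integrals, hence equality almost everywhere. -/
theorem eq_of_lintegral_excess_le {d : ℕ} {C D : Set (Rd d)} {I : Set ℝ≥0∞}
    {α κ : ℝ≥0} {g h : Rd d → ℝ≥0} (hh : Measurable h) (h_int : ∫⁻ x, (h x : ℝ≥0∞) < ⊤)
    {f₀ f : C(Rd d, ℝ)} (hf₀ : f₀ ∈ contClass C D I α κ g h)
    (hf : f ∈ contClass C D I α κ g h)
    (hle : ∫⁻ x, excess (ofCont f₀ x) (h x) (ofCont f x) ∂(volume.withDensity (ofCont f₀)) ≤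
      ∫⁻ x, excess (ofCont f₀ x) (h x) (ofCont f₀ x) ∂(volume.withDensity (ofCont f₀))) :
    ofCont f = ofCont f₀ := by
  have m₀ : Measurable (ofCont f₀) := (continuous_ofCont f₀).measurable
  have m : Measurable (ofCont f) := (continuous_ofCont f).measurable
  have i₀ : ∫⁻ x, ofCont f₀ x = 1 := hf₀.2.2.1
  have i : ∫⁻ x, ofCont f x = 1 := hf.2.2.1
  have hae := ae_withDensity_pos_lt_top (μ := volume) m₀ (by rw [i₀]; exact ENNReal.one_ne_top)
  set μ := (volume : Measure (Rd d)).withDensity (ofCont f₀) with hμ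
  have hμ1 : μ Set.univ = 1 := by
    rw [hμ, withDensity_apply _ MeasurableSet.univ, setLIntegral_univ, i₀]
  have hH : ∫⁻ x, h x / ofCont f₀ x ∂μ ≠ ⊤ :=
    ne_top_of_le_ne_top h_int.ne (lintegral_div_withDensity_le m₀ hh.coe_nnreal_ennreal)
  have hself : ∫⁻ x, excess (ofCont f₀ x) (h x) (ofCont f₀ x) ∂μ =
      ∫⁻ x, h x / ofCont f₀ x ∂μ :=
    lintegral_congr_ae (hae.mono fun x hx => excess_self hx.1 hx.2)
  have hgibbs := fun x (hx : ofCont f₀ x ≠ 0 ∧ ofCont f₀ x ≠ ⊤) =>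
    div_add_one_le_excess_add hx.1 hx.2 ENNReal.coe_ne_top (ofCont_le hf.1 x)
  have hsum : ∫⁻ x, (h x / ofCont f₀ x + 1) ∂μ = ∫⁻ x, h x / ofCont f₀ x ∂μ + 1 := by
    rw [lintegral_add_right _ measurable_const, lintegral_const, hμ1, one_mul]
  have hmex : Measurable fun x => excess (ofCont f₀ x) (h x) (ofCont f x) :=
    measurable_excess m₀ hh.coe_nnreal_ennreal m
  have heq := ae_eq_of_ae_le_of_lintegral_le
    (f := fun x => h x / ofCont f₀ x + 1)
    (g := fun x => excess (ofCont f₀ x) (h x) (ofCont f x) + ofCont f x / ofCont f₀ x)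
    (hae.mono fun x hx => (hgibbs x hx).1)
    (by rw [hsum]; exact ENNReal.add_ne_top.2 ⟨hH, ENNReal.one_ne_top⟩)
    (hmex.add (m.div m₀)).aemeasurable
    (by
      rw [hsum, lintegral_add_left hmex, ← hself]
      exact add_le_add hle (i ▸ lintegral_div_withDensity_le m₀ m))
  -- Equality is known only where `f₀ > 0`, which yields `f₀ ≤ f` Lebesgue-almost everywhere. Equal
  -- total mass then gives equality almost everywhere, and continuity gives it everywhere.
  have hle_ae : ofCont f₀ ≤ᵐ[volume] ofCont f := by
    have : ∀ᵐ x ∂μ, ofCont f x = ofCont f₀ x := by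
      filter_upwards [hae, heq] with x hx hxe
      exact (hgibbs x hx).2 hxe
    rw [hμ, ae_withDensity_iff m₀] at this
    filter_upwards [this] with x hx
    by_cases h0 : ofCont f₀ x = 0
    · rw [h0]; exact zero_le
    · exact (hx h0).ge
  have := ae_eq_of_ae_le_of_lintegral_le hle_ae (by rw [i₀]; exact ENNReal.one_ne_top)
    m.aemeasurable (by rw [i, i₀])
  exact (((continuous_ofCont f₀).ae_eq_iff_eq volume (continuous_ofCont f)).1 this).symm

/-- Limits of near-minimizers of the averages minimize the mean. -/
theorem lintegral_excess_le_of_tendsto {d : ℕ} {μ : Measure (Rd d)} {f₀ : Rd d → ℝ≥0∞}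
    {h : Rd d → ℝ≥0} (hf₀ : Measurable f₀) (hμ : ∀ᵐ x ∂μ, f₀ x ≠ 0 ∧ f₀ x ≠ ⊤)
    (hh : Measurable h) {S : Set C(Rd d, ℝ)} {x : ℕ → Rd d}
    (hS : ∀ U ∈ TopologicalSpace.countableBasis C(Rd d, ℝ),
      Tendsto (fun n : ℕ => (∑ j ∈ Finset.range n,
          excess (f₀ (x j)) (h (x j)) (upperEnvelope (S ∩ U) (x j))) / n) atTop
        (𝓝 (∫⁻ y, excess (f₀ y) (h y) (upperEnvelope (S ∩ U) y) ∂μ)))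
    {k : Rd d → ℝ≥0∞}
    (hk : Tendsto (fun n : ℕ => (∑ j ∈ Finset.range n,
          excess (f₀ (x j)) (h (x j)) (k (x j))) / n) atTop
        (𝓝 (∫⁻ y, excess (f₀ y) (h y) (k y) ∂μ)))
    {ε : ℕ → ℝ} (hε : Tendsto ε atTop (𝓝 0)) {N : ℕ → ℕ} (hN : Tendsto N atTop atTop)
    {F : ℕ → C(Rd d, ℝ)} (hF : ∀ i, F i ∈ S) {f : C(Rd d, ℝ)} (hf : f ∈ S)
    (hlim : Tendsto F atTop (𝓝 f))
    (hmin : ∀ᶠ i in atTop, (∑ j ∈ Finset.range (N i),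
          excess (f₀ (x j)) (h (x j)) (ofCont (F i) (x j))) / (N i : ℝ≥0∞) ≤
        (∑ j ∈ Finset.range (N i), excess (f₀ (x j)) (h (x j)) (k (x j))) / (N i : ℝ≥0∞) +
          ENNReal.ofReal (ε (N i))) :
    ∫⁻ y, excess (f₀ y) (h y) (ofCont f y) ∂μ ≤ ∫⁻ y, excess (f₀ y) (h y) (k y) ∂μ := by
  refine lintegral_excess_le_of_basis hf₀ hμ hh hf fun U hU hfU => ?_
  have hnear : ∀ᶠ i in atTop, F i ∈ U :=
    hlim.eventually ((TopologicalSpace.isOpen_of_mem_countableBasis hU).mem_nhds hfU)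
  have hright := (hk.comp hN).add ((ENNReal.tendsto_ofReal hε).comp hN)
  rw [ENNReal.ofReal_zero, add_zero] at hright
  refine le_of_tendsto_of_tendsto ((hS U hU).comp hN) hright ?_
  -- Once `F i` lies in `U`, it is below the envelope over `S ∩ U`, so its excess is at least that
  -- of the envelope.
  filter_upwards [hnear, hmin] with i hi hmini
  refine le_trans ?_ hmini
  dsimp only [Function.comp_apply]
  gcongr with j _
  exact excess_anti _ _ (le_iSup₂ (f := fun (g : C(Rd d, ℝ)) (_ : g ∈ S ∩ U) => ofCont g (x j))
    (F i) ⟨hF i, hi⟩)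

theorem tendsto_awDist_ofCont {d : ℕ} (c : Rd d × ℝ) {κ : ℝ≥0} {h : Rd d → ℝ≥0}
    (h_int : ∫⁻ x, (h x : ℝ≥0∞) < ⊤) {F : ℕ → C(Rd d, ℝ)} {f : C(Rd d, ℝ)}
    (hF : ∀ n, F n ∈ envelope κ h) (hf : f ∈ envelope κ h) (hlim : Tendsto F atTop (𝓝 f)) :
    Tendsto (fun n => awDist c (toExt (ofCont (F n))) (toExt (ofCont f))) atTop (𝓝 0) := by
  have hle : ∀ {a b : C(Rd d, ℝ)} {δ : ℝ}, 0 ≤ δ → (∀ x, 0 ≤ b x) → (∀ x, a x ≤ b x + δ) →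
      ∀ x, toExt (ofCont a) x ≤ toExt (ofCont b) x + δ := by
    intro a b δ hδ hb hab x
    have hδ' : (δ : EReal) = ((ENNReal.ofReal δ : ℝ≥0∞) : EReal) := by
      rw [EReal.coe_ennreal_ofReal, max_eq_left hδ]
    rw [toExt, toExt, hδ', ← EReal.coe_ennreal_add, EReal.coe_ennreal_le_coe_ennreal_iff, ofCont,
      ofCont, ← ENNReal.ofReal_add (hb x) hδ]
    exact ENNReal.ofReal_le_ofReal (hab x)
  rw [Metric.tendsto_nhds]
  intro δ hδ
  filter_upwards [eventually_abs_sub_le h_int hF hf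
    (fun x => ((continuous_eval_const x).tendsto f).comp hlim) (half_pos hδ)] with n hn
  rw [Real.dist_0_eq_abs, abs_of_nonneg (awDist_nonneg _ _ _)]
  refine lt_of_le_of_lt (awDist_le_of_forall_le_add c
    (toExt_mem_uscFcns (continuous_ofCont _).upperSemicontinuous)
    (toExt_mem_uscFcns (continuous_ofCont _).upperSemicontinuous) (half_pos hδ).le
    (hle (half_pos hδ).le (fun x => (hf.1 x).1) fun x => by linarith [(abs_le.1 (hn x)).2])
    (hle (half_pos hδ).le (fun x => ((hF n).1 x).1) fun x => by linarith [(abs_le.1 (hn x)).1]))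
    (half_lt_self hδ)

end AwML

/-! ### Consistency of the near-minimizers -/

theorem proposition2p1 {d : ℕ}
    (C D : Set (AwML.Rd d)) (I : Set ℝ≥0∞) (hI : IsClosed I) (α κ : ℝ≥0)
    (g h : AwML.Rd d → ℝ≥0) (h_usc : UpperSemicontinuous h)
    (h_int : ∫⁻ x, (h x : ℝ≥0∞) < ⊤)
    (hF : (AwML.densityClass C D I α κ g h).Nonempty)
    {Ω : Type*} [MeasurableSpace Ω] (P : Measure Ω) [IsProbabilityMeasure P]
    (f₀ : AwML.Rd d → ℝ≥0∞) (hf₀ : Measurable f₀)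
    (X : ℕ → Ω → AwML.Rd d) (hX : ∀ j, Measurable (X j)) (hX_indep : iIndepFun X P)
    (hX_law : ∀ j, P.map (X j) = (volume : Measure (AwML.Rd d)).withDensity f₀)
    (ε : ℕ → ℝ) (hε_nonneg : ∀ n, 0 ≤ ε n) (hε : Tendsto ε atTop (𝓝 0))
    (c : AwML.Rd d × ℝ) :
    ∀ᵐ ω ∂P,
      (∀ n : ℕ, 1 ≤ n →
        (AwML.epsArgmin (ε n) (AwML.densityClass C D I α κ g h)
          (AwML.mlCriterion n fun j => X j ω)).Nonempty) ∧
      ∀ fhat : ℕ → AwML.Rd d → ℝ≥0∞,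
        (∀ n : ℕ, 1 ≤ n →
          fhat n ∈ AwML.epsArgmin (ε n) (AwML.densityClass C D I α κ g h)
            (AwML.mlCriterion n fun j => X j ω)) →
        (∃ u, AwML.IsAwClusterPt c (fun n => AwML.toExt (fhat n)) u) ∧
        (∀ u, AwML.IsAwClusterPt c (fun n => AwML.toExt (fhat n)) u →
          ∃ f ∈ AwML.densityClass C D I α κ g h, u = AwML.toExt f ∧
            ∀ f' ∈ AwML.densityClass C D I α κ g h, AwML.kl f₀ f ≤ AwML.kl f₀ f') ∧
        (f₀ ∈ AwML.densityClass C D I α κ g h →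
          Tendsto (fun n => AwML.awDist c (AwML.toExt (fhat n)) (AwML.toExt f₀))
            atTop (𝓝 0)) := by
  have hh : Measurable h := h_usc.measurable
  have hprob : IsProbabilityMeasure ((volume : Measure (AwML.Rd d)).withDensity f₀) := by
    rw [← hX_law 0]
    exact Measure.isProbabilityMeasure_map (hX 0).aemeasurable
  have hint : ∫⁻ x, f₀ x ≠ ⊤ := by
    have := hprob.measure_univ
    rw [withDensity_apply _ MeasurableSet.univ, setLIntegral_univ] at this
    rw [this]
    exact ENNReal.one_ne_top
  have hpos := AwML.ae_withDensity_pos_lt_top hf₀ hint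
  obtain ⟨f₁, hf₁⟩ := hF
  obtain ⟨F₁, hF₁, -⟩ := AwML.exists_ofCont_eq hf₁
  have hcomp : IsCompact (AwML.contClass C D I α κ g h) := AwML.isCompact_contClass hI h_int
  let R : C(AwML.Rd d, ℝ) → ℝ≥0∞ := fun f =>
    ∫⁻ x, AwML.excess (f₀ x) (h x) (AwML.ofCont f x) ∂(volume.withDensity f₀)
  -- Comparing with a countable minimizing sequence, rather than every member of the class, keeps
  -- the exceptional set null.
  obtain ⟨r, -, hr_lim, hr_mem⟩ := exists_seq_tendsto_sInf
    (S := R '' AwML.contClass C D I α κ g h) ⟨_, F₁, hF₁, rfl⟩ (OrderBot.bddBelow _)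
  choose K hK hKr using hr_mem
  have hslln := fun (s : AwML.Rd d → ℝ≥0∞) (hs : Measurable s) =>
    AwML.tendsto_average_lintegral hX hX_indep hX_law
      (AwML.measurable_excess hf₀ hh.coe_nnreal_ennreal hs)
  have hgood : ∀ᵐ ω ∂P, ∀ j, f₀ (X j ω) ≠ 0 ∧ f₀ (X j ω) ≠ ⊤ := ae_all_iff.2 fun j =>
    ae_of_ae_map (hX j).aemeasurable (by rw [hX_law j]; exact hpos)
  have hK_ae := ae_all_iff.2 fun m => hslln _ (AwML.continuous_ofCont (K m)).measurable
  have hU_ae := (ae_ball_iff (TopologicalSpace.countable_countableBasis C(AwML.Rd d, ℝ))).2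
    fun U _ => hslln _
      (AwML.measurable_upperEnvelope (AwML.contClass C D I α κ g h ∩ U))
  filter_upwards [hgood, hK_ae, hU_ae] with ω hω hKω hUω
  refine ⟨fun n _ => AwML.epsArgmin_mlCriterion_nonempty hI h_int ⟨f₁, hf₁⟩ (hε_nonneg n) n _,
    fun fhat hfhat => ?_⟩
  -- Nothing is assumed about `fhat 0`, so `F₁` fills that index.
  have hex : ∀ n, ∃ G ∈ AwML.contClass C D I α κ g h, 1 ≤ n → AwML.ofCont G = fhat n := by
    intro n
    by_cases hn : 1 ≤ n
    · obtain ⟨G, hG, he⟩ := AwML.exists_ofCont_eq (hfhat n hn).1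
      exact ⟨G, hG, fun _ => he⟩
    · exact ⟨F₁, hF₁, fun h => absurd h hn⟩
  choose G hG hGf using hex
  -- Taken along arbitrary index sequences, this yields existence of a cluster point, optimality of
  -- each one, and the subsequence criterion for convergence.
  have hsub : ∀ N : ℕ → ℕ, Tendsto N atTop atTop → ∃ φ : ℕ → ℕ, StrictMono φ ∧
      ∃ f ∈ AwML.contClass C D I α κ g h,
        (∀ f' ∈ AwML.contClass C D I α κ g h, R f ≤ R f') ∧
        Tendsto (fun i => AwML.awDist c (AwML.toExt (fhat (N (φ i))))
          (AwML.toExt (AwML.ofCont f))) atTop (𝓝 0) := by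
    intro N hN
    obtain ⟨f, hf, φ, hφ, hlim⟩ := hcomp.isSeqCompact fun i => hG (N i)
    have hNφ : Tendsto (fun i => N (φ i)) atTop atTop := hN.comp hφ.tendsto_atTop
    refine ⟨φ, hφ, f, hf, fun f' hf' => ?_, ?_⟩
    · refine le_trans ?_ (sInf_le (Set.mem_image_of_mem R hf'))
      refine ge_of_tendsto' hr_lim fun m => ?_
      rw [← hKr m]
      refine AwML.lintegral_excess_le_of_tendsto hf₀ hpos hh hUω (hKω m) hε hNφ
        (fun i => hG _) hf hlim ?_
      filter_upwards [hNφ.eventually_ge_atTop 1] with i hi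
      refine AwML.average_excess_le hi (fun j => (hω j).1) (fun j => (hω j).2)
        (AwML.ofCont_le (hG _).1) (AwML.ofCont_le (hK m).1) (hε_nonneg _) ?_
      rw [hGf _ hi]
      refine (hfhat _ hi).2.trans ?_
      gcongr
      exact iInf₂_le _ (hK m).2
    · refine (AwML.tendsto_awDist_ofCont c h_int (fun i => (hG (N (φ i))).1) hf.1 hlim).congr' ?_
      filter_upwards [hNφ.eventually_ge_atTop 1] with i hi
      rw [hGf _ hi]
  refine ⟨?_, ?_, ?_⟩
  · obtain ⟨φ, hφ, f, hf, -, hlim⟩ := hsub id tendsto_id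
    exact ⟨_, AwML.toExt_mem_uscFcns hf.2.1, φ, hφ, hlim⟩
  · rintro u ⟨hu, φ, hφ, hlim⟩
    -- A further subsequence tends to a minimizer in the class; uniqueness of aw-limits identifies
    -- it with `u`.
    obtain ⟨ψ, hψ, f, hf, hmin, hlim'⟩ := hsub φ hφ.tendsto_atTop
    refine ⟨AwML.ofCont f, hf.2, ?_, fun f' hf' => ?_⟩
    · refine AwML.eq_of_awDist_le_zero (c := c) hu (AwML.toExt_mem_uscFcns hf.2.1) ?_
      have hsum := (hlim.comp hψ.tendsto_atTop).add hlim'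
      rw [add_zero] at hsum
      refine ge_of_tendsto' hsum fun i => ?_
      refine (AwML.awDist_triangle c u (AwML.toExt (fhat (φ (ψ i)))) _).trans ?_
      rw [AwML.awDist_comm c u]
      rfl
    · obtain ⟨F', hF', rfl⟩ := AwML.exists_ofCont_eq hf'
      rw [AwML.kl_eq hf₀ hint hh h_int (AwML.continuous_ofCont f).measurable
          (AwML.ofCont_le hf.1),
        AwML.kl_eq hf₀ hint hh h_int (AwML.continuous_ofCont F').measurable
          (AwML.ofCont_le hF'.1)]
      exact EReal.sub_le_sub (EReal.coe_ennreal_le_coe_ennreal_iff.2 (hmin F' hF')) le_rfl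
  · intro hf₀F
    obtain ⟨F₀, hF₀, rfl⟩ := AwML.exists_ofCont_eq hf₀F
    refine tendsto_of_subseq_tendsto fun N hN => ?_
    obtain ⟨φ, -, f, hf, hmin, hlim⟩ := hsub N hN
    rw [AwML.eq_of_lintegral_excess_le hh h_int hF₀ hf (hmin F₀ hF₀)] at hlim
    exact ⟨φ, hlim⟩
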